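/- Let $d$ be a natural number. For $u:\mathbb{Z}^d\to\mathbb{R}$ write $\Delta u(z)=\sum_{i=1}^d\big(u(z+e_i)+u(z-e_i)-2u(z)\big)$ for the discrete Laplacian, and let $L$ be the Laplacian on $\mathbb{R}^d$. For $p\in\mathbb{R}^d$ let $H(p)=\Delta u_p(0)$, where $u_p:\mathbb{Z}^d\to\mathbb{R}$ is the unique function with $\Delta u_p(x)=0$ when $p\cdot x>0$, $u_p(x)=0$ when $p\cdot x\le 0$, and $\sup_{p\cdot x>0}|u_p(x)-p\cdot x|<\infty$ (so $H(0)=0$). Theorem. Suppose that $U\subseteq\mathbb{R}^d$ is open and bounded, $\varphi\in C^\infty(U)$, $L\varphi\le 0$ in $\{x\in U:\varphi(x)>0\}$, $\Sigma\subseteq\mathbb{R}^d$ is a linear subspace, $\nabla\varphi(x)\in\Sigma$ for all $x\in U$, and $$\limsup_{p\to\nabla\varphi(x),\ p\in\Sigma}H(p)\le 1\quad\text{for every } x\in U \text{ with } \varphi(x)=0.$$ (The limsup does not exclude $p=\nabla\varphi(x)$.) Let $V$ be open with $\overline V\subseteq U$, and let $(h_n)$ be a sequence of real numbers with $h_n\to\infty$.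 Then there are functions $u_n:\mathbb{Z}^d\to[0,\infty)$ and numbers $\varepsilon_n\to0$ such that, for every $n$ and every $z\in\mathbb{Z}^d\cap h_nV$, say $z=h_nx$ with $x\in V$, $$\Delta u_n(z)\le(1+\varepsilon_n)\,\mathbf 1_{\{u_n=0\}}(z)\qquad\text{and}\qquad\big|h_n^{-1}u_n(h_nx)-\max\{\varphi(x),0\}\big|\le\varepsilon_n .$$ -/

import Mathlib

open Filter Topology
open scoped ContDiff

/-- The lattice point `z ∈ ℤ^d`, viewed as a point of Euclidean space `ℝ^d`. -/
def latticePoint {d : ℕ} (z : Fin d → ℤ) : EuclideanSpace ℝ (Fin d) :=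
  WithLp.toLp 2 (fun i => (z i : ℝ))

/-- The (unnormalized) discrete Laplacian on `ℤ^d`:
`Δu(z) = ∑_i (u(z + e_i) + u(z - e_i) - 2 u(z))`. -/
def discreteLaplacian {d : ℕ} (u : (Fin d → ℤ) → ℝ) (z : Fin d → ℤ) : ℝ :=
  ∑ i, (u (z + Pi.single i 1) + u (z - Pi.single i 1) - 2 * u z)

/-- `u : ℤ^d → ℝ` solves the half-space problem with slope `p`: it is discrete harmonic in
`{p · x > 0}`, vanishes in `{p · x ≤ 0}`, and stays at bounded distance from the linear function
`p · x` in `{p · x > 0}`. -/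
structure IsHalfSpaceSolution {d : ℕ} (p : EuclideanSpace ℝ (Fin d))
    (u : (Fin d → ℤ) → ℝ) : Prop where
  harmonic : ∀ x, 0 < inner ℝ p (latticePoint x) → discreteLaplacian u x = 0
  eq_zero : ∀ x, inner ℝ p (latticePoint x) ≤ 0 → u x = 0
  bounded : ∃ C : ℝ, ∀ x, 0 < inner ℝ p (latticePoint x) →
    |u x - inner ℝ p (latticePoint x)| ≤ C

open Classical in
/-- The Hamiltonian `H(p) = Δu(0)`, where `u` is the solution of the half-space problem with
slope `p` (which exists and is unique for every `p`; for `p = 0` it is `u = 0`, so that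
`H(0) = 0`). -/
noncomputable def hamiltonian {d : ℕ} (p : EuclideanSpace ℝ (Fin d)) : ℝ :=
  if h : ∃ u : (Fin d → ℤ) → ℝ, IsHalfSpaceSolution p u then
    discreteLaplacian h.choose 0
  else 0

/-! No continuity of H is available, so it does not suffice that the zero set of `u` looks like a
half space near a free boundary point: at a fixed lattice scale N it must contain every lattice
point y with p · y ≤ 0, for an exact slope p in the subspace S.

First perturb φ to f = φ − κ(1 + ‖P_S x‖²). This is superharmonic for fine lattices where f ≥ 0
(`exists_secondDifference_nonpos`), and its gradient still lies in S. Then enlarge {f < 0} by a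
small fixed zonotope spanned by the lattice vectors of a box of size N. A point of the sum is e + ∑
t_y y with f(e) < 0, and a penalised minimisation makes t_y ≤ 0 whenever ∇f(e) · y ≤ 0
(`exists_latticeComb_nonpos`). For such y there is room to raise t_y by 1/h, so the translate by y/h
stays in the enlarged set. This produces the exact half ball, with p = ∇f(e).

Let D be the complement of the enlarged set near the compact set, and `u` the least function above a
truncation of h(f − α) that is superharmonic in D; it vanishes off D. Every translate of hf by a
zonotope vector, plus a constant, is a competitor, so near a boundary point `u` is at most p · y +
O(1). Comparison with the half-space solution in a ball of radius N gives Δu ≤ H(p) + O(1/N)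
(`discreteLaplacian_le_hamiltonian`). Since φ(e) is near 0 and p is near ∇φ(e), compactness and the
limsup hypothesis bound H(p) (`exists_hamiltonian_le`). -/

section Lattice

variable {d : ℕ}

/-! ### Lattice points and algebra of the discrete Laplacian. -/

@[simp]
theorem latticePoint_apply (z : Fin d → ℤ) (i : Fin d) : latticePoint z i = (z i : ℝ) := rfl

@[simp]
theorem latticePoint_zero : latticePoint (0 : Fin d → ℤ) = 0 := by
  ext i; simp

theorem latticePoint_add (z w : Fin d → ℤ) :
    latticePoint (z + w) = latticePoint z + latticePoint w := by
  ext i; simp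

theorem latticePoint_sub (z w : Fin d → ℤ) :
    latticePoint (z - w) = latticePoint z - latticePoint w := by
  ext i; simp

theorem latticePoint_single (i : Fin d) :
    latticePoint (Pi.single i 1) = EuclideanSpace.single i (1 : ℝ) := by
  ext j
  by_cases h : j = i
  · subst h; simp
  · simp [h]

theorem inner_single_one (x : EuclideanSpace ℝ (Fin d)) (i : Fin d) :
    inner ℝ x (EuclideanSpace.single i (1 : ℝ)) = x i := by
  simp [EuclideanSpace.inner_single_right]

/-- The lattice points all of whose coordinates have absolute value at most `N`. -/
noncomputable def latticeBox (d N : ℕ) : Finset (Fin d → ℤ) :=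
  Fintype.piFinset fun _ => Finset.Icc (-(N : ℤ)) N

theorem mem_latticeBox_of_norm_le {N : ℕ} {y : Fin d → ℤ} (hy : ‖latticePoint y‖ ≤ N) :
    y ∈ latticeBox d N := by
  rw [latticeBox, Fintype.mem_piFinset]
  intro i
  have h1 : ‖latticePoint y i‖ ≤ N := (PiLp.norm_apply_le _ i).trans hy
  rw [latticePoint_apply, Real.norm_eq_abs, abs_le] at h1
  rw [Finset.mem_Icc]
  exact ⟨by exact_mod_cast h1.1, by exact_mod_cast h1.2⟩

theorem discreteLaplacian_mono {u v : (Fin d → ℤ) → ℝ} {z : Fin d → ℤ} (hz : u z = v z)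
    (hadd : ∀ i, u (z + Pi.single i 1) ≤ v (z + Pi.single i 1))
    (hsub : ∀ i, u (z - Pi.single i 1) ≤ v (z - Pi.single i 1)) :
    discreteLaplacian u z ≤ discreteLaplacian v z := by
  refine Finset.sum_le_sum fun i _ => ?_
  have := hadd i
  have := hsub i
  rw [hz]
  linarith

theorem discreteLaplacian_sub (u v : (Fin d → ℤ) → ℝ) (z : Fin d → ℤ) :
    discreteLaplacian (fun y => u y - v y) z = discreteLaplacian u z - discreteLaplacian v z := by
  simp only [discreteLaplacian, ← Finset.sum_sub_distrib]
  exact Finset.sum_congr rfl fun i _ => by ring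

theorem discreteLaplacian_const_mul (c : ℝ) (u : (Fin d → ℤ) → ℝ) (z : Fin d → ℤ) :
    discreteLaplacian (fun y => c * u y) z = c * discreteLaplacian u z := by
  simp only [discreteLaplacian, Finset.mul_sum]
  exact Finset.sum_congr rfl fun i _ => by ring

theorem discreteLaplacian_add_left (u : (Fin d → ℤ) → ℝ) (z y : Fin d → ℤ) :
    discreteLaplacian (fun y => u (z + y)) y = discreteLaplacian u (z + y) := by
  simp only [discreteLaplacian, add_assoc, add_sub_assoc]

/-! ### Obstacle problem and comparison in half balls. -/

/-- The discrete obstacle problem: the least function above `g` which is superharmonic on `D`. -/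
theorem exists_obstacle_solution (D : Set (Fin d → ℤ)) (g v₀ : (Fin d → ℤ) → ℝ)
    (hv₀ : ∀ z, g z ≤ v₀ z) (hv₀D : ∀ z ∈ D, discreteLaplacian v₀ z ≤ 0) :
    ∃ u : (Fin d → ℤ) → ℝ, (∀ z, g z ≤ u z) ∧ (∀ z ∈ D, discreteLaplacian u z ≤ 0) ∧
      (∀ v : (Fin d → ℤ) → ℝ, (∀ z, g z ≤ v z) → (∀ z ∈ D, discreteLaplacian v z ≤ 0) →
        ∀ z, u z ≤ v z) ∧
      (∀ z ∉ D, u z = g z) ∧ ∀ z ∈ D, g z < u z → 0 ≤ discreteLaplacian u z := by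
  classical
  set A : Set ((Fin d → ℤ) → ℝ) :=
    {v | (∀ z, g z ≤ v z) ∧ ∀ z ∈ D, discreteLaplacian v z ≤ 0} with hA
  have hv₀A : v₀ ∈ A := ⟨hv₀, hv₀D⟩
  have hne : Nonempty A := ⟨⟨v₀, hv₀A⟩⟩
  have hbdd : ∀ z, BddBelow (Set.range fun v : A => v.1 z) := fun z =>
    ⟨g z, by rintro _ ⟨v, rfl⟩; exact v.2.1 z⟩
  set u : (Fin d → ℤ) → ℝ := fun z => ⨅ v : A, v.1 z with hu
  have hule : ∀ v ∈ A, ∀ z, u z ≤ v z := fun v hv z => ciInf_le (hbdd z) ⟨v, hv⟩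
  have hgu : ∀ z, g z ≤ u z := fun z => le_ciInf fun v => v.2.1 z
  have huD : ∀ z ∈ D, discreteLaplacian u z ≤ 0 := by
    intro z hz
    -- Δu + 2d u is the sum over neighbours, which is monotone in u; hence superharmonicity passes
    -- to infima.
    have key : ∀ v : A, discreteLaplacian u z + 2 * d * u z ≤ 2 * d * v.1 z := by
      intro v
      have h1 := v.2.2 z hz
      have h2 : discreteLaplacian u z + 2 * d * u z ≤
          discreteLaplacian v.1 z + 2 * d * v.1 z := by
        have h3 : ∀ w : (Fin d → ℤ) → ℝ, discreteLaplacian w z + 2 * d * w z =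
            ∑ i, (w (z + Pi.single i 1) + w (z - Pi.single i 1)) := by
          intro w
          simp only [discreteLaplacian, Finset.sum_sub_distrib, Finset.sum_const,
            Finset.card_univ, Fintype.card_fin, nsmul_eq_mul]
          ring
        rw [h3, h3]
        exact Finset.sum_le_sum fun i _ => add_le_add (hule _ v.2 _) (hule _ v.2 _)
      linarith
    rcases Nat.eq_zero_or_pos d with h0 | hd
    · subst h0; simp [discreteLaplacian]
    · have hd' : (0 : ℝ) < 2 * d := by positivity
      have h4 : (discreteLaplacian u z + 2 * d * u z) / (2 * d) ≤ u z :=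
        le_ciInf fun v => by rw [div_le_iff₀ hd']; linarith [key v]
      rw [div_le_iff₀ hd'] at h4
      linarith
  have huA : u ∈ A := ⟨hgu, huD⟩
  -- Lowering a competitor at one point only decreases the Laplacian elsewhere, so only the
  -- condition at z needs checking.
  have lower : ∀ z c, g z ≤ c → c ≤ u z →
      (z ∈ D → discreteLaplacian (Function.update u z c) z ≤ 0) → u z ≤ c := by
    intro z c hgc hcu hz
    have hle : ∀ y, Function.update u z c y ≤ u y := by
      intro y
      by_cases hy : y = z
      · subst hy; simpa using hcu
      · simp [hy]
    have hmem : Function.update u z c ∈ A := by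
      refine ⟨fun y => ?_, fun y hy => ?_⟩
      · by_cases h : y = z
        · subst h; simpa using hgc
        · simpa [h] using hgu y
      · by_cases h : y = z
        · subst h; exact hz hy
        · exact (discreteLaplacian_mono (by simp [h]) (fun i => hle _) (fun i => hle _)).trans
            (huD y hy)
    simpa using hule _ hmem z
  refine ⟨u, hgu, huD, fun v h1 h2 => hule v ⟨h1, h2⟩, fun z hz => ?_, fun z hz hgz => ?_⟩
  · exact le_antisymm (lower z (g z) le_rfl (hgu z) fun h => absurd h hz) (hgu z)
  · by_contra hneg
    push Not at hneg
    have hd : 0 < d := by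
      rcases Nat.eq_zero_or_pos d with h0 | hd
      · subst h0; simp [discreteLaplacian] at hneg
      · exact hd
    have hd' : (0 : ℝ) < 2 * d := by positivity
    -- m is the average of u over the neighbours of z. If Δu(z) < 0, u could be lowered to max(g,
    -- m).
    set m := u z + discreteLaplacian u z / (2 * d) with hm
    have hmu : m < u z := by
      have := div_neg_of_neg_of_pos hneg hd'
      linarith
    have hlap : ∀ c, discreteLaplacian (Function.update u z c) z = 2 * d * (m - c) := by
      intro c
      have h1 : ∀ i : Fin d, z + Pi.single i 1 ≠ z := fun i h => by
        have := congrFun h i; simp at this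
      have h2 : ∀ i : Fin d, z - Pi.single i 1 ≠ z := fun i h => by
        have := congrFun h i; simp at this
      have h3 : discreteLaplacian (Function.update u z c) z =
          discreteLaplacian u z + 2 * d * (u z - c) := by
        simp only [discreteLaplacian, Function.update_of_ne (h1 _), Function.update_of_ne (h2 _),
          Function.update_self, Finset.sum_sub_distrib, Finset.sum_const,
            Finset.card_univ, Fintype.card_fin, nsmul_eq_mul]
        ring
      rw [h3, hm]
      field_simp
      ring
    have := lower z (max (g z) m) (le_max_left _ _) (max_le hgz.le hmu.le) fun _ => by
      rw [hlap]
      exact mul_nonpos_of_nonneg_of_nonpos hd'.le (sub_nonpos.2 (le_max_right _ _))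
    exact absurd this (not_le.2 (max_lt hgz hmu))

/-- Comparison in a half ball: a function which is at most `M` on a ball, nonpositive outside the
half space, and subharmonic where it is positive, is `O(M / R)` near the centre. -/
theorem le_of_subharmonic_halfBall {p : EuclideanSpace ℝ (Fin d)} (hp : p ≠ 0) {R M : ℝ}
    (hR : 2 ≤ R) (hM : 0 < M) (v : (Fin d → ℤ) → ℝ)
    (hsub : ∀ y, ‖latticePoint y‖ < R → 0 < inner ℝ p (latticePoint y) → 0 < v y →
      0 ≤ discreteLaplacian v y)
    (hvM : ∀ y, ‖latticePoint y‖ ≤ R + 1 → v y ≤ M)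
    (hv0 : ∀ y, ‖latticePoint y‖ < R → inner ℝ p (latticePoint y) ≤ 0 → v y ≤ 0)
    (y : Fin d → ℤ) (hy : ‖latticePoint y‖ < R) :
    v y ≤ M * (‖latticePoint y‖ ^ 2 + 2 * (d + 1) * (‖latticePoint y‖ + 1)) / R := by
  classical
  have hpn : 0 < ‖p‖ := norm_pos_iff.2 hp
  set q : EuclideanSpace ℝ (Fin d) := ‖p‖⁻¹ • p with hq
  have hqn : ‖q‖ = 1 := by
    rw [hq, norm_smul, norm_inv, norm_norm, inv_mul_cancel₀ hpn.ne']
  have hpq : ∀ x, inner ℝ p x = ‖p‖ * inner ℝ q x := fun x => by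
    rw [hq, real_inner_smul_left, ← mul_assoc, mul_inv_cancel₀ hpn.ne', one_mul]
  have hqle : ∀ x, inner ℝ q x ≤ ‖x‖ := fun x => by
    simpa [hqn] using real_inner_le_norm q x
  -- Barrier: the quadratic terms give Δb = 2d − 2(d + 1) = −2. The shift by 1 keeps b ≥ ‖y‖² on
  -- neighbours of the half space, where q · y ≥ −1. Near the centre b grows only linearly in R, but
  -- b ≥ R² for ‖y‖ ≥ R; hence c = M / R².
  set b : (Fin d → ℤ) → ℝ := fun y => ‖latticePoint y‖ ^ 2 +
    2 * (d + 1) * R * (inner ℝ q (latticePoint y) + 1) -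
    (d + 1) * (inner ℝ q (latticePoint y) + 1) ^ 2 with hb
  have hblap : ∀ y, discreteLaplacian b y = -2 := by
    intro y
    have hq2 : ∑ i, (q i) ^ 2 = 1 := by
      rw [← EuclideanSpace.real_norm_sq_eq, hqn, one_pow]
    have h1 : ∀ i, b (y + Pi.single i 1) + b (y - Pi.single i 1) - 2 * b y =
        2 - 2 * (d + 1) * (q i) ^ 2 := by
      intro i
      have e1 : ‖latticePoint y + EuclideanSpace.single i (1 : ℝ)‖ ^ 2 =
          ‖latticePoint y‖ ^ 2 + 2 * y i + 1 := by
        rw [norm_add_sq_real, inner_single_one]; simp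
      have e2 : ‖latticePoint y - EuclideanSpace.single i (1 : ℝ)‖ ^ 2 =
          ‖latticePoint y‖ ^ 2 - 2 * y i + 1 := by
        rw [norm_sub_sq_real, inner_single_one]; simp
      simp only [hb, latticePoint_add, latticePoint_sub, latticePoint_single, e1, e2,
        inner_add_right, inner_sub_right, inner_single_one]
      ring
    simp only [discreteLaplacian, h1]
    rw [Finset.sum_sub_distrib, ← Finset.mul_sum, hq2]
    simp
    ring
  have hbs : ∀ y, -1 ≤ inner ℝ q (latticePoint y) → ‖latticePoint y‖ ≤ R + 1 →
      ‖latticePoint y‖ ^ 2 ≤ b y := by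
    intro y h1 h2
    have h3 := (hqle (latticePoint y)).trans h2
    have h4 : 0 ≤ (d + 1 : ℝ) * ((inner ℝ q (latticePoint y) + 1) *
        (2 * R - (inner ℝ q (latticePoint y) + 1))) :=
      mul_nonneg (by positivity) (mul_nonneg (by linarith) (by linarith))
    simp only [hb]
    nlinarith
  set A : Finset (Fin d → ℤ) := (latticeBox d ⌈R⌉₊).filter
    fun y => ‖latticePoint y‖ < R ∧ 0 < inner ℝ p (latticePoint y) with hA
  have hmemA : ∀ y, y ∈ A ↔ ‖latticePoint y‖ < R ∧ 0 < inner ℝ p (latticePoint y) := by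
    intro y
    rw [hA, Finset.mem_filter, and_iff_right_iff_imp]
    exact fun h => mem_latticeBox_of_norm_le (h.1.le.trans (Nat.le_ceil R))
  set c := M / R ^ 2 with hc
  have hc0 : 0 < c := by positivity
  set w : (Fin d → ℤ) → ℝ := fun y => v y - c * b y with hw
  have hsingle : ∀ i : Fin d, ‖EuclideanSpace.single i (1 : ℝ)‖ = 1 := fun i => by simp
  have hnb : ∀ y ∈ A, ∀ y' : Fin d → ℤ, ‖latticePoint y' - latticePoint y‖ ≤ 1 → y' ∉ A →
      w y' ≤ 0 := by
    intro y hyA y' hyy' hy'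
    rw [hmemA] at hyA hy'
    have h1 : ‖latticePoint y'‖ ≤ R + 1 := by
      have := norm_le_norm_add_norm_sub (latticePoint y) (latticePoint y')
      rw [norm_sub_rev] at this
      linarith [hyA.1]
    have h2 : -1 ≤ inner ℝ q (latticePoint y') := by
      have h3 : 0 < inner ℝ q (latticePoint y) := by
        have := hyA.2
        rw [hpq] at this
        exact pos_of_mul_pos_right this hpn.le
      have h4 := hqle (latticePoint y - latticePoint y')
      rw [inner_sub_right, norm_sub_rev] at h4
      linarith
    have h3 := hbs y' h2 h1
    have hb0 : 0 ≤ b y' := (sq_nonneg _).trans h3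
    by_cases h4 : ‖latticePoint y'‖ < R
    · have h5 := hv0 y' h4 (not_lt.1 fun h => hy' ⟨h4, h⟩)
      have := mul_nonneg hc0.le hb0
      simp only [hw]; linarith
    · push Not at h4
      have h5 := hvM y' h1
      have h6 : R ^ 2 ≤ b y' := (pow_le_pow_left₀ (by linarith) h4 2).trans h3
      have h7 : M ≤ c * b y' := by
        calc M = c * R ^ 2 := by rw [hc]; field_simp
          _ ≤ _ := mul_le_mul_of_nonneg_left h6 hc0.le
      simp only [hw]; linarith
  have hwA : ∀ y ∈ A, w y ≤ 0 := by
    by_contra! hcon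
    obtain ⟨y₀, hy₀, hpos⟩ := hcon
    obtain ⟨y₁, hy₁, hmax⟩ := A.exists_max_image w ⟨y₀, hy₀⟩
    have hw1 : 0 < w y₁ := hpos.trans_le (hmax y₀ hy₀)
    have hnb' : ∀ y', ‖latticePoint y' - latticePoint y₁‖ ≤ 1 → w y' ≤ w y₁ := by
      intro y' hy'
      by_cases h : y' ∈ A
      · exact hmax y' h
      · exact (hnb y₁ hy₁ y' hy' h).trans hw1.le
    -- Maximum principle: a positive maximum forces Δw ≤ 0, whereas Δw ≥ 2c there.
    have h1 : discreteLaplacian w y₁ ≤ 0 := by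
      refine Finset.sum_nonpos fun i _ => ?_
      have h2 := hnb' (y₁ + Pi.single i 1) (by
        rw [latticePoint_add, latticePoint_single, add_sub_cancel_left, hsingle])
      have h3 := hnb' (y₁ - Pi.single i 1) (by
        rw [latticePoint_sub, latticePoint_single, sub_sub_cancel_left, norm_neg, hsingle])
      linarith
    have h2 := (hmemA y₁).1 hy₁
    have hq1 : 0 < inner ℝ q (latticePoint y₁) := by
      have := h2.2
      rw [hpq] at this
      exact pos_of_mul_pos_right this hpn.le
    have hb1 : 0 ≤ b y₁ :=
      (sq_nonneg _).trans (hbs y₁ (by linarith) (by linarith [h2.1]))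
    have hv1 : 0 < v y₁ := by
      have := mul_nonneg hc0.le hb1
      simp only [hw] at hw1; linarith
    have h3 := hsub y₁ h2.1 h2.2 hv1
    have h4 : discreteLaplacian w y₁ = discreteLaplacian v y₁ - c * discreteLaplacian b y₁ := by
      rw [hw, discreteLaplacian_sub, discreteLaplacian_const_mul]
    rw [h4, hblap] at h1
    linarith
  have hn := norm_nonneg (latticePoint y)
  by_cases hpy : 0 < inner ℝ p (latticePoint y)
  · have h1 := hwA y ((hmemA y).2 ⟨hy, hpy⟩)
    have h2 : b y ≤ R * (‖latticePoint y‖ ^ 2 + 2 * (d + 1) * (‖latticePoint y‖ + 1)) := by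
      have h3 : (d + 1 : ℝ) * R * inner ℝ q (latticePoint y) ≤ (d + 1) * R * ‖latticePoint y‖ :=
        mul_le_mul_of_nonneg_left (hqle _) (by positivity)
      have h4 : 0 ≤ (d + 1 : ℝ) * (inner ℝ q (latticePoint y) + 1) ^ 2 := by positivity
      have h5 : ‖latticePoint y‖ ^ 2 ≤ R * ‖latticePoint y‖ ^ 2 :=
        le_mul_of_one_le_left (sq_nonneg _) (by linarith)
      simp only [hb]
      nlinarith
    have h3 : c * b y ≤ c * (R * (‖latticePoint y‖ ^ 2 +
        2 * (d + 1) * (‖latticePoint y‖ + 1))) := mul_le_mul_of_nonneg_left h2 hc0.le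
    have h4 : c * (R * (‖latticePoint y‖ ^ 2 + 2 * (d + 1) * (‖latticePoint y‖ + 1))) =
        M * (‖latticePoint y‖ ^ 2 + 2 * (d + 1) * (‖latticePoint y‖ + 1)) / R := by
      rw [hc]; field_simp
    simp only [hw] at h1
    linarith
  · exact (hv0 y hy (not_lt.1 hpy)).trans (by positivity)

/-! ### Half-space solutions and the Hamiltonian. -/

theorem discreteLaplacian_inner (p : EuclideanSpace ℝ (Fin d)) (c : ℝ) (z : Fin d → ℤ) :
    discreteLaplacian (fun z => inner ℝ p (latticePoint z) + c) z = 0 := by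
  refine Finset.sum_eq_zero fun i _ => ?_
  simp only [latticePoint_add, latticePoint_sub, inner_add_right, inner_sub_right]
  ring

/-- The difference p · y − u is bounded above, harmonic in the half space and nonpositive outside
it; let R → ∞ in the half-ball comparison. -/
theorem IsHalfSpaceSolution.inner_le {p : EuclideanSpace ℝ (Fin d)} {u : (Fin d → ℤ) → ℝ}
    (hu : IsHalfSpaceSolution p u) (y : Fin d → ℤ) : inner ℝ p (latticePoint y) ≤ u y := by
  rcases eq_or_ne p 0 with rfl | hp
  · rw [hu.eq_zero y (by simp)]; simp
  obtain ⟨C, hC⟩ := hu.bounded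
  set M := max C 0 + 1 with hM
  have hMpos : 0 < M := by positivity
  set K := M * (‖latticePoint y‖ ^ 2 + 2 * (d + 1) * (‖latticePoint y‖ + 1)) with hK
  have key : ∀ R : ℝ, 2 ≤ R → ‖latticePoint y‖ < R →
      inner ℝ p (latticePoint y) - u y ≤ K / R := by
    intro R hR hyR
    have hv0 : ∀ y, inner ℝ p (latticePoint y) ≤ 0 → inner ℝ p (latticePoint y) - u y ≤ 0 :=
      fun y h => by rw [hu.eq_zero y h]; linarith
    refine le_of_subharmonic_halfBall hp hR hMpos
      (fun y => inner ℝ p (latticePoint y) - u y) (fun y _ h _ => ?_) (fun y _ => ?_)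
      (fun y _ h => hv0 y h) y hyR
    · rw [discreteLaplacian_sub, hu.harmonic y h, sub_zero]
      simpa using (discreteLaplacian_inner p 0 y).ge
    · by_cases h : 0 < inner ℝ p (latticePoint y)
      · have := (abs_le.1 (hC y h)).1
        have := le_max_left C 0
        linarith
      · exact (hv0 y (not_lt.1 h)).trans hMpos.le
  have hlim : Tendsto (fun R : ℝ => K / R) atTop (𝓝 0) := tendsto_const_nhds.div_atTop tendsto_id
  have := ge_of_tendsto hlim (by
    filter_upwards [eventually_ge_atTop 2, eventually_gt_atTop ‖latticePoint y‖] with R h1 h2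
    exact key R h1 h2)
  linarith

/-- Perron's method between max(p · x, 0) and p · x + ‖p‖. A lattice step changes p · x by at most
‖p‖, so the upper barrier may be cut to 0 off the half space and remain superharmonic inside. -/
theorem exists_isHalfSpaceSolution (p : EuclideanSpace ℝ (Fin d)) :
    ∃ u : (Fin d → ℤ) → ℝ, IsHalfSpaceSolution p u := by
  classical
  set D : Set (Fin d → ℤ) := {z | 0 < inner ℝ p (latticePoint z)} with hD
  set g : (Fin d → ℤ) → ℝ := fun z => max (inner ℝ p (latticePoint z)) 0 with hg
  set v : (Fin d → ℤ) → ℝ := fun z => if z ∈ D then inner ℝ p (latticePoint z) + ‖p‖ else 0 with hv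
  have hle : ∀ z i, 0 < inner ℝ p (latticePoint z) →
      0 ≤ inner ℝ p (latticePoint (z + Pi.single i 1)) + ‖p‖ ∧
      0 ≤ inner ℝ p (latticePoint (z - Pi.single i 1)) + ‖p‖ := by
    intro z i hz
    have h1 := abs_le.1 (abs_real_inner_le_norm p (EuclideanSpace.single i (1 : ℝ)))
    have h2 : ‖EuclideanSpace.single i (1 : ℝ)‖ = 1 := by simp
    rw [h2, mul_one] at h1
    rw [latticePoint_add, latticePoint_sub, latticePoint_single, inner_add_right, inner_sub_right]
    exact ⟨by linarith [h1.1], by linarith [h1.2]⟩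
  have hvD : ∀ z ∈ D, discreteLaplacian v z ≤ 0 := by
    intro z hz
    have h0 : ∀ y, 0 ≤ inner ℝ p (latticePoint y) + ‖p‖ →
        v y ≤ inner ℝ p (latticePoint y) + ‖p‖ := by
      intro y hy
      simp only [hv]
      split_ifs
      · exact le_rfl
      · exact hy
    refine (discreteLaplacian_mono (if_pos hz) (fun i => h0 _ (hle z i hz).1)
      (fun i => h0 _ (hle z i hz).2)).trans (discreteLaplacian_inner p ‖p‖ z).le
  have hgv : ∀ z, g z ≤ v z := by
    intro z
    by_cases hz : z ∈ D
    · simp only [hg, hv, if_pos hz]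
      have := norm_nonneg p
      exact max_le (by linarith) (by linarith [show 0 < inner ℝ p (latticePoint z) from hz])
    · simp only [hg, hv, if_neg hz]
      exact max_le (not_lt.1 hz) le_rfl
  obtain ⟨u, hgu, huD, hmin, huoff, hsub⟩ := exists_obstacle_solution D g v hgv hvD
  refine ⟨u, fun x hx => le_antisymm (huD x hx) ?_, fun x hx => ?_, ‖p‖, fun x hx => ?_⟩
  · rcases (hgu x).lt_or_eq with h | h
    · exact hsub x hx h
    -- At a contact point u is touched from below by a linear function, so Δu ≥ 0 there too.
    · have h1 : ∀ y, inner ℝ p (latticePoint y) + 0 ≤ u y := fun y => by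
        rw [add_zero]; exact (le_max_left _ _).trans (hgu y)
      rw [← discreteLaplacian_inner p 0 x]
      refine discreteLaplacian_mono ?_ (fun i => h1 _) (fun i => h1 _)
      rw [← h, add_zero]
      exact (max_eq_left (le_of_lt hx)).symm
  · rw [huoff x (not_lt.2 hx)]
    exact max_eq_right hx
  · have h1 := hmin v hgv hvD x
    simp only [hv, if_pos (show x ∈ D from hx)] at h1
    have h2 := (le_max_left _ _).trans (hgu x)
    rw [abs_le]
    exact ⟨by linarith [norm_nonneg p], by linarith⟩

/-- Uniqueness is not needed: the comparison applies to whichever solution the definition selects.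
-/
theorem exists_hamiltonian_eq (p : EuclideanSpace ℝ (Fin d)) :
    ∃ u : (Fin d → ℤ) → ℝ, IsHalfSpaceSolution p u ∧ hamiltonian p = discreteLaplacian u 0 := by
  have h := exists_isHalfSpaceSolution p
  exact ⟨h.choose, h.choose_spec, dif_pos h⟩

/-- If `u` vanishes on a half ball about `z` with normal `p`, is at most `p · y + C` in the ball,
and is subharmonic where it is positive, then `Δu(z) ≤ H(p) + O(C / R)`. -/
theorem discreteLaplacian_le_hamiltonian {p : EuclideanSpace ℝ (Fin d)} (hp : p ≠ 0) {R C : ℝ}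
    (hR : 2 ≤ R) (hC : 0 < C) (u : (Fin d → ℤ) → ℝ) (z : Fin d → ℤ)
    (hsub : ∀ y, ‖latticePoint y‖ < R → 0 < u (z + y) → 0 ≤ discreteLaplacian u (z + y))
    (huC : ∀ y, ‖latticePoint y‖ ≤ R + 1 →
      u (z + y) ≤ max (inner ℝ p (latticePoint y) + C) 0)
    (hu0 : ∀ y, ‖latticePoint y‖ < R → inner ℝ p (latticePoint y) ≤ 0 → u (z + y) = 0) :
    discreteLaplacian u z ≤ hamiltonian p + 2 * d * (C * (4 * d + 5)) / R := by
  obtain ⟨v, hv, hHv⟩ := exists_hamiltonian_eq p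
  have hv0 : ∀ y, 0 ≤ v y := by
    intro y
    by_cases h : 0 < inner ℝ p (latticePoint y)
    · exact h.le.trans (hv.inner_le y)
    · exact (hv.eq_zero y (not_lt.1 h)).ge
  -- Since v ≥ 0, u is positive wherever u − v is, so subharmonicity is required only there.
  have key := le_of_subharmonic_halfBall hp hR hC (fun y => u (z + y) - v y)
    (fun y hy hpy hpos => by
      rw [discreteLaplacian_sub, hv.harmonic y hpy, sub_zero, discreteLaplacian_add_left]
      exact hsub y hy (by have := hv0 y; linarith))
    (fun y hy => by
      have h1 := huC y hy
      have h2 := hv.inner_le y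
      have h3 := hv0 y
      have h4 : max (inner ℝ p (latticePoint y) + C) 0 ≤ v y + C :=
        max_le (by linarith) (by linarith)
      linarith)
    (fun y hy hpy => by
      simp only [hu0 y hy hpy]; linarith [hv0 y])
  have key1 : ∀ y : Fin d → ℤ, ‖latticePoint y‖ = 1 →
      u (z + y) ≤ v y + C * (4 * d + 5) / R := by
    intro y hy
    have h1 := key y (by rw [hy]; linarith)
    rw [hy] at h1
    have h2 : C * ((1 : ℝ) ^ 2 + 2 * (d + 1) * (1 + 1)) = C * (4 * d + 5) := by ring
    rw [h2] at h1
    linarith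
  have hz : u z = 0 := by simpa using hu0 0 (by simp; linarith) (by simp)
  have hvz : v 0 = 0 := hv.eq_zero 0 (by simp)
  have hsum : discreteLaplacian u z ≤
      ∑ i : Fin d, ((v (0 + Pi.single i 1) + v (0 - Pi.single i 1) - 2 * v 0) +
        2 * (C * (4 * d + 5) / R)) := by
    refine Finset.sum_le_sum fun i _ => ?_
    have h1 := key1 (Pi.single i 1) (by rw [latticePoint_single]; simp)
    have h2 := key1 (-Pi.single i 1) (by
      rw [← zero_sub, latticePoint_sub, latticePoint_single]; simp)
    rw [hz, hvz, zero_add, zero_sub, sub_eq_add_neg z]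
    linarith
  rw [Finset.sum_add_distrib] at hsum
  refine hsum.trans (le_of_eq ?_)
  rw [hHv]
  simp only [discreteLaplacian, Finset.sum_const, Finset.card_univ, Fintype.card_fin,
    nsmul_eq_mul]
  ring

end Lattice

/-! ### Second differences, Taylor bounds and gradients. -/

section Calculus

/-- With m slightly above ∂ᵢᵢf(x), uniform continuity of the second derivative makes f(x + t eᵢ) − m
t²/2 concave in t on [−s, s]; evaluate at the midpoint. -/
theorem exists_secondDifference_le {d : ℕ} {U K : Set (EuclideanSpace ℝ (Fin d))}
    (hU : IsOpen U) (hK : IsCompact K) (hKU : K ⊆ U) {f : EuclideanSpace ℝ (Fin d) → ℝ}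
    (hf : ContDiffOn ℝ 2 f U) {η : ℝ} (hη : 0 < η) :
    ∃ s₀ > (0 : ℝ), ∀ x ∈ K, ∀ s : ℝ, 0 < s → s < s₀ →
      ∑ i, (f (x + s • EuclideanSpace.single i (1 : ℝ)) +
        f (x - s • EuclideanSpace.single i (1 : ℝ)) - 2 * f x) ≤
      s ^ 2 * (Laplacian.laplacian f x + η) := by
  obtain ⟨r, hr, hrU⟩ := hK.exists_cthickening_subset_open hU hKU
  have hf1 : ContDiffOn ℝ 1 (fderiv ℝ f) U := hf.fderiv_of_isOpen hU le_rfl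
  have hf2 : ContinuousOn (fderiv ℝ (fderiv ℝ f)) U := hf1.continuousOn_fderiv_of_isOpen hU le_rfl
  set G : EuclideanSpace ℝ (Fin d) → Fin d → ℝ := fun x i =>
    fderiv ℝ (fderiv ℝ f) x (EuclideanSpace.single i 1) (EuclideanSpace.single i 1) with hG
  have hGc : ContinuousOn G U := by
    refine continuousOn_pi.2 fun i => ?_
    exact (hf2.clm_apply continuousOn_const).clm_apply continuousOn_const
  have huc := (hK.cthickening (r := r)).uniformContinuousOn_of_continuous (hGc.mono hrU)
  have hη' : 0 < η / (d + 1) := by positivity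
  obtain ⟨s₁, hs₁, hs₁G⟩ := Metric.uniformContinuousOn_iff.1 huc _ hη'
  refine ⟨min r s₁, lt_min hr hs₁, fun x hx s hs hss => ?_⟩
  have hsr := hss.trans_le (min_le_left _ _)
  have hss1 := hss.trans_le (min_le_right _ _)
  have hone : ∀ i : Fin d, f (x + s • EuclideanSpace.single i (1 : ℝ)) +
      f (x - s • EuclideanSpace.single i (1 : ℝ)) - 2 * f x ≤ s ^ 2 * (G x i + η / (d + 1)) := by
    intro i
    set e : EuclideanSpace ℝ (Fin d) := EuclideanSpace.single i 1 with he
    have hen : ‖e‖ = 1 := by simp [he]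
    set m := G x i + η / (d + 1) with hm
    have hdist : ∀ t ∈ Set.Icc (-s) s, dist (x + t • e) x ≤ s := by
      intro t ht
      rw [dist_eq_norm, add_sub_cancel_left, norm_smul, hen, mul_one]
      exact abs_le.2 ht
    have hmem : ∀ t ∈ Set.Icc (-s) s, x + t • e ∈ Metric.cthickening r K := fun t ht =>
      Metric.mem_cthickening_of_dist_le _ x r K hx ((hdist t ht).trans hsr.le)
    have hline : ∀ t : ℝ, HasDerivAt (fun t : ℝ => x + t • e) e t := fun t => by
      simpa using ((hasDerivAt_id t).smul_const e).const_add x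
    have h1 : ∀ t ∈ Set.Icc (-s) s,
        HasDerivAt (fun t => f (x + t • e) - m / 2 * t ^ 2)
          (fderiv ℝ f (x + t • e) e - m * t) t := by
      intro t ht
      have h2 := ((hf.differentiableOn (by simp)).differentiableAt
        (hU.mem_nhds (hrU (hmem t ht)))).hasFDerivAt.comp_hasDerivAt t (hline t)
      have h3 := ((hasDerivAt_id t).pow 2).const_mul (m / 2)
      refine (h2.sub h3).congr_deriv ?_
      simp only [id, Nat.cast_ofNat]; ring
    have h2 : ∀ t ∈ Set.Icc (-s) s,
        HasDerivAt (fun t => fderiv ℝ f (x + t • e) e - m * t) (G (x + t • e) i - m) t := by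
      intro t ht
      have h2 := ((hf1.differentiableOn (by simp)).differentiableAt
        (hU.mem_nhds (hrU (hmem t ht)))).hasFDerivAt.comp_hasDerivAt t (hline t)
      have h3 := h2.clm_apply (hasDerivAt_const t e)
      refine (h3.sub ((hasDerivAt_id t).const_mul m)).congr_deriv ?_
      simp [hG, he]
    have hconc : ConcaveOn ℝ (Set.Icc (-s) s) (fun t => f (x + t • e) - m / 2 * t ^ 2) := by
      refine concaveOn_of_hasDerivWithinAt2_nonpos (convex_Icc _ _)
        (fun t ht => (h1 t ht).continuousAt.continuousWithinAt)
        (fun t ht => (h1 t (interior_subset ht)).hasDerivWithinAt)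
        (fun t ht => (h2 t (interior_subset ht)).hasDerivWithinAt) (fun t ht => ?_)
      have ht' := interior_subset ht
      have h3 := hs₁G _ (hmem t ht') _ (Metric.self_subset_cthickening K hx)
        ((hdist t ht').trans_lt hss1)
      have h4 := (dist_le_pi_dist (G (x + t • e)) (G x) i).trans_lt h3
      rw [Real.dist_eq] at h4
      have := (abs_lt.1 h4).2
      linarith
    have h3 := hconc.2 (Set.right_mem_Icc.2 (by linarith)) (Set.left_mem_Icc.2 (by linarith))
      (show (0 : ℝ) ≤ 1 / 2 by norm_num) (show (0 : ℝ) ≤ 1 / 2 by norm_num) (by norm_num)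
    simp only [smul_eq_mul, neg_smul, ← sub_eq_add_neg] at h3
    rw [show (1 / 2 * s + 1 / 2 * -s : ℝ) = 0 by ring] at h3
    simp only [zero_smul, add_zero] at h3
    nlinarith
  have hlap : Laplacian.laplacian f x = ∑ i, G x i := by
    rw [InnerProductSpace.laplacian_eq_iteratedFDeriv_orthonormalBasis f
      (EuclideanSpace.basisFun (Fin d) ℝ)]
    simp [hG, iteratedFDeriv_two_apply]
  calc _ ≤ ∑ i, s ^ 2 * (G x i + η / (d + 1)) := Finset.sum_le_sum fun i _ => hone i
    _ = s ^ 2 * (Laplacian.laplacian f x + d * (η / (d + 1))) := by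
      rw [← Finset.mul_sum, Finset.sum_add_distrib, hlap]; simp
    _ ≤ _ := by
      have : d * (η / (d + 1)) ≤ η := by
        rw [mul_div_assoc', div_le_iff₀ (by positivity)]; nlinarith
      gcongr

variable {E : Type*} [NormedAddCommGroup E]

/-- The estimate is confined to balls inside K because K need not be convex. -/
theorem exists_lipschitz_bound [NormedSpace ℝ E] {U K : Set E} (hU : IsOpen U) (hK : IsCompact K)
    (hKU : K ⊆ U) {f : E → ℝ} (hf : ContDiffOn ℝ 1 f U) :
    ∃ L > 0, ∀ x r, Metric.closedBall x r ⊆ K → ∀ y ∈ Metric.closedBall x r,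
      ∀ y' ∈ Metric.closedBall x r, |f y' - f y| ≤ L * ‖y' - y‖ := by
  obtain ⟨L, hL⟩ := hK.exists_bound_of_continuousOn
    ((hf.continuousOn_fderiv_of_isOpen hU le_rfl).mono hKU)
  refine ⟨max L 1, by positivity, fun x r hr y hy y' hy' => ?_⟩
  exact (convex_closedBall x r).norm_image_sub_le_of_norm_fderiv_le
    (fun z hz => (hf.differentiableOn one_ne_zero).differentiableAt (hU.mem_nhds (hKU (hr hz))))
    (fun z hz => (hL z (hr hz)).trans (le_max_left _ _)) hy hy'

theorem exists_taylor_bound [NormedSpace ℝ E] {U K : Set E} (hU : IsOpen U) (hK : IsCompact K)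
    (hKU : K ⊆ U) {f : E → ℝ} (hf : ContDiffOn ℝ 1 f U) {η : ℝ} (hη : 0 < η) :
    ∃ s₀ > (0 : ℝ), ∀ x r, r < s₀ → Metric.closedBall x r ⊆ K → ∀ v, ‖v‖ ≤ r →
      f (x + v) ≤ f x + fderiv ℝ f x v + η * ‖v‖ := by
  have huc := hK.uniformContinuousOn_of_continuous
    ((hf.continuousOn_fderiv_of_isOpen hU le_rfl).mono hKU)
  obtain ⟨s, hs, hsf⟩ := Metric.uniformContinuousOn_iff.1 huc _ hη
  refine ⟨s, hs, fun x r hr hx v hv => ?_⟩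
  have hxx : x ∈ Metric.closedBall x r := Metric.mem_closedBall_self ((norm_nonneg v).trans hv)
  have h1 := (convex_closedBall x r).norm_image_sub_le_of_norm_fderiv_le' (f := f)
    (φ := fderiv ℝ f x) (C := η) (x := x) (y := x + v)
    (fun z hz => (hf.differentiableOn one_ne_zero).differentiableAt (hU.mem_nhds (hKU (hx hz))))
    (fun z hz => by
      rw [← dist_eq_norm]
      exact (hsf z (hx hz) x (hx hxx) ((Metric.mem_closedBall.1 hz).trans_lt hr)).le) hxx
    (by simpa [Metric.mem_closedBall, dist_eq_norm] using hv)
  rw [add_sub_cancel_left] at h1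
  have := (abs_le.1 h1).2
  linarith

theorem ContDiffOn.continuousOn_gradient [InnerProductSpace ℝ E] [CompleteSpace E] {U : Set E}
    (hU : IsOpen U) {f : E → ℝ} (hf : ContDiffOn ℝ 1 f U) : ContinuousOn (gradient f) U :=
  (InnerProductSpace.toDual ℝ E).symm.continuous.comp_continuousOn
    (hf.continuousOn_fderiv_of_isOpen hU le_rfl)

theorem inner_gradient [InnerProductSpace ℝ E] [CompleteSpace E] (f : E → ℝ) (x v : E) :
    inner ℝ (gradient f x) v = fderiv ℝ f x v := by
  rw [gradient, InnerProductSpace.toDual_symm_apply]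

end Calculus

/-! ### Uniform form of the limsup condition. -/

section Hamiltonian

variable {d : ℕ}

/-- By compactness: counterexamples with η = 1/(k + 1) accumulate at a point a with φ(a) = 0, and
their slopes tend to ∇φ(a) within S, against the limsup bound. -/
theorem exists_hamiltonian_le {U K : Set (EuclideanSpace ℝ (Fin d))} (hU : IsOpen U)
    (hK : IsCompact K) (hKU : K ⊆ U) {φ : EuclideanSpace ℝ (Fin d) → ℝ}
    (hφ : ContDiffOn ℝ 1 φ U) (S : Set (EuclideanSpace ℝ (Fin d)))
    (hH : ∀ x ∈ U, φ x = 0 →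
      limsup (fun p => (hamiltonian p : EReal)) (𝓝[S] (gradient φ x)) ≤ 1)
    {ε : ℝ} (hε : 0 < ε) :
    ∃ η > 0, ∀ x ∈ K, |φ x| ≤ η → ∀ p ∈ S, ‖p - gradient φ x‖ ≤ η → hamiltonian p ≤ 1 + ε := by
  by_contra! hcon
  have hpos : ∀ k : ℕ, (0 : ℝ) < 1 / (k + 1) := fun k => Nat.one_div_pos_of_nat
  choose x hxK hx p hpS hp hHp using fun k : ℕ => hcon (1 / (k + 1)) (hpos k)
  obtain ⟨a, haK, ψ, hψ, ha⟩ := hK.tendsto_subseq hxK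
  have hlim0 : Tendsto (fun k => 1 / ((ψ k : ℝ) + 1)) atTop (𝓝 0) :=
    tendsto_one_div_add_atTop_nhds_zero_nat.comp hψ.tendsto_atTop
  have haU := hU.mem_nhds (hKU haK)
  have hφa : φ a = 0 := by
    have h1 : Tendsto (fun k => φ (x (ψ k))) atTop (𝓝 (φ a)) :=
      (hφ.continuousOn.continuousAt haU).tendsto.comp ha
    exact tendsto_nhds_unique h1 (squeeze_zero_norm (fun k => hx (ψ k)) hlim0)
  have hpa : Tendsto (fun k => p (ψ k)) atTop (𝓝[S] (gradient φ a)) := by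
    refine tendsto_nhdsWithin_iff.2 ⟨?_, Eventually.of_forall fun k => hpS (ψ k)⟩
    have h1 : Tendsto (fun k => gradient φ (x (ψ k))) atTop (𝓝 (gradient φ a)) :=
      ((hφ.continuousOn_gradient hU).continuousAt haU).tendsto.comp ha
    have h2 := squeeze_zero_norm (fun k => hp (ψ k)) hlim0
    simpa using h2.add h1
  have hlt : limsup (fun p => (hamiltonian p : EReal)) (𝓝[S] (gradient φ a)) <
      ((1 + ε : ℝ) : EReal) :=
    (hH a (hKU haK) hφa).trans_lt (by exact_mod_cast (by linarith : (1 : ℝ) < 1 + ε))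
  obtain ⟨k, hk⟩ := (hpa.eventually (eventually_lt_of_limsup_lt hlt)).exists
  exact absurd (EReal.coe_lt_coe_iff.1 hk) (not_lt.2 (hHp (ψ k)).le)

end Hamiltonian

/-! ### Minkowski sums with lattice zonotopes. -/

section Zonotope

variable {d : ℕ}

/-- The combination `∑ t_y y` of the lattice vectors in `Y`. -/
noncomputable def latticeComb (Y : Finset (Fin d → ℤ)) : (Y → ℝ) →ₗ[ℝ] EuclideanSpace ℝ (Fin d) :=
  Fintype.linearCombination ℝ fun y : Y => latticePoint y.1

theorem latticeComb_single (Y : Finset (Fin d → ℤ)) (y : Y) (s : ℝ) :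
    latticeComb Y (Pi.single y s) = s • latticePoint y.1 := by
  classical
  rw [latticeComb, Fintype.linearCombination_apply_single]

theorem norm_latticeComb_le {Y : Finset (Fin d → ℤ)} {t : Y → ℝ} {δ : ℝ} (ht : ∀ y, |t y| ≤ δ) :
    ‖latticeComb Y t‖ ≤ δ * ∑ y ∈ Y, ‖latticePoint y‖ := by
  rw [latticeComb, Fintype.linearCombination_apply, ← Finset.sum_coe_sort Y, Finset.mul_sum]
  refine (norm_sum_le _ _).trans (Finset.sum_le_sum fun y _ => ?_)
  rw [norm_smul]
  exact mul_le_mul_of_nonneg_right (ht y) (norm_nonneg _)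

/-- A point of the Minkowski sum of `{f < 0}` with the zonotope spanned by `Y` can be written as
`e + ∑ t_y y` with `f e < 0` and `t_y ≤ 0` whenever `∇f(e) · y ≤ 0`. -/
theorem exists_latticeComb_nonpos {Y : Finset (Fin d → ℤ)} {f : EuclideanSpace ℝ (Fin d) → ℝ}
    {x : EuclideanSpace ℝ (Fin d)} {δ : ℝ}
    (hf : ∀ t : Y → ℝ, (∀ y, |t y| ≤ δ) → DifferentiableAt ℝ f (x - latticeComb Y t))
    {t₀ : Y → ℝ} (ht₀ : ∀ y, |t₀ y| ≤ δ) (hft₀ : f (x - latticeComb Y t₀) < 0) :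
    ∃ t : Y → ℝ, (∀ y, |t y| ≤ δ) ∧ f (x - latticeComb Y t) < 0 ∧
      ∀ y : Y, fderiv ℝ f (x - latticeComb Y t) (latticePoint y.1) ≤ 0 → t y ≤ 0 := by
  classical
  set A : Set (Y → ℝ) := Set.Icc (fun _ => -δ) (fun _ => δ) with hA
  have hmem : ∀ t, t ∈ A ↔ ∀ y, |t y| ≤ δ := by
    intro t
    simp only [hA, Set.mem_Icc, Pi.le_def, abs_le]
    exact ⟨fun h y => ⟨h.1 y, h.2 y⟩, fun h => ⟨fun y => (h y).1, fun y => (h y).2⟩⟩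
  set c := f (x - latticeComb Y t₀) with hc
  set T := ∑ y, t₀ y ^ 2 with hT
  have hT0 : 0 ≤ T := Finset.sum_nonneg fun y _ => sq_nonneg _
  -- Small enough that the penalised functional is still negative at `t₀`, hence at its minimiser.
  set τ := -c / (T + 1) with hτ
  have hτ0 : 0 < τ := div_pos (neg_pos.2 hft₀) (by positivity)
  set F : (Y → ℝ) → ℝ := fun t => f (x - latticeComb Y t) + τ * ∑ y, t y ^ 2 with hF
  have hFc : ContinuousOn F A := by
    refine ContinuousOn.add (fun t ht => ?_) (by fun_prop)
    have h1 : Continuous fun t => x - latticeComb Y t :=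
      continuous_const.sub (LinearMap.continuous_of_finiteDimensional _)
    exact (ContinuousAt.comp (g := f) (f := fun t => x - latticeComb Y t)
      (hf t ((hmem t).1 ht)).continuousAt h1.continuousAt).continuousWithinAt
  obtain ⟨t, htA, htmin⟩ := isCompact_Icc.exists_isMinOn ⟨t₀, (hmem t₀).2 ht₀⟩ hFc
  have ht := (hmem t).1 htA
  refine ⟨t, ht, ?_, fun y hy => ?_⟩
  · have h1 : F t ≤ F t₀ := htmin ((hmem t₀).2 ht₀)
    have h2 : 0 ≤ τ * ∑ y, t y ^ 2 :=
      mul_nonneg hτ0.le (Finset.sum_nonneg fun y _ => sq_nonneg _)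
    have h3 : F t₀ < 0 := by
      have : τ * (T + 1) = -c := by rw [hτ]; field_simp
      have h4 : F t₀ = c + τ * T := rfl
      linarith
    have h5 : F t = f (x - latticeComb Y t) + τ * ∑ y, t y ^ 2 := rfl
    linarith
  · by_contra! hty
    set e := x - latticeComb Y t with he
    -- Up to a constant, g(s) is F after lowering t_y by s. If ∇f(e) · y ≤ 0 < t_y, the penalty
    -- makes g′(0) strictly negative, contradicting minimality.
    set g : ℝ → ℝ := fun s => f (e + s • latticePoint y.1) + τ * (s ^ 2 - 2 * s * t y) with hg
    have hline : HasDerivAt (fun s : ℝ => e + s • latticePoint y.1) (latticePoint y.1) 0 := by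
      simpa using ((hasDerivAt_id (0 : ℝ)).smul_const (latticePoint y.1)).const_add e
    have hgd : HasDerivAt g (fderiv ℝ f e (latticePoint y.1) - τ * (2 * t y)) 0 := by
      have h1 : HasFDerivAt f (fderiv ℝ f e) (e + (0 : ℝ) • latticePoint y.1) := by
        simpa using (hf t ht).hasFDerivAt
      have h2 := h1.comp_hasDerivAt (0 : ℝ) hline
      have h3 : HasDerivAt (fun s : ℝ => τ * (s ^ 2 - 2 * s * t y)) (-(τ * (2 * t y))) 0 := by
        have h4 := (((hasDerivAt_id (0 : ℝ)).pow 2).sub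
          (((hasDerivAt_id (0 : ℝ)).const_mul 2).mul_const (t y))).const_mul τ
        refine h4.congr_deriv ?_
        simp
      exact (h2.add h3).congr_deriv (by ring)
    have hneg : fderiv ℝ f e (latticePoint y.1) - τ * (2 * t y) < 0 := by
      have := mul_pos hτ0 hty
      linarith
    have hslope := (hasDerivAt_iff_tendsto_slope.1 hgd).mono_left
      (nhdsGT_le_nhdsNE (0 : ℝ))
    have hev := (hslope.eventually (gt_mem_nhds hneg)).and
      (Ioo_mem_nhdsGT (show (0 : ℝ) < t y by exact hty))
    obtain ⟨s, hs1, hs0, hst⟩ := hev.exists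
    rw [slope_def_field, sub_zero] at hs1
    have hgs : g s < g 0 := by
      have := (div_lt_iff₀ hs0).1 hs1
      linarith
    have hmem' : t - Pi.single y s ∈ A := by
      rw [hmem]
      intro j
      by_cases hj : j = y
      · subst hj
        have := abs_le.1 (ht j)
        simp only [Pi.sub_apply, Pi.single_eq_same, abs_le]
        exact ⟨by linarith, by linarith⟩
      · simpa [hj] using ht j
    have h1 : F t ≤ F (t - Pi.single y s) := htmin hmem'
    have h2 : x - latticeComb Y (t - Pi.single y s) = e + s • latticePoint y.1 := by
      rw [map_sub, latticeComb_single, he]; abel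
    have h3 : ∑ j, (t - Pi.single y s : Y → ℝ) j ^ 2 = ∑ j, t j ^ 2 + (s ^ 2 - 2 * s * t y) := by
      have : ∀ j, (t - Pi.single y s : Y → ℝ) j ^ 2 =
          t j ^ 2 + if j = y then s ^ 2 - 2 * s * t y else 0 := by
        intro j
        by_cases hj : j = y
        · subst hj; simp; ring
        · simp [hj]
      rw [Finset.sum_congr rfl fun j _ => this j, Finset.sum_add_distrib]
      simp
    simp only [hF, h2, h3] at h1
    simp only [hg, zero_smul, add_zero] at hgs
    linarith

end Zonotope

/-! ### The discrete supersolution at scale h. -/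

section Construction

variable {d : ℕ}

/-- The radius 3ρ allows ρ for the neighbourhood of K₀ containing D, ρ for a zonotope translation,
and ρ for lattice steps. -/
theorem exists_discrete_supersolution {f : EuclideanSpace ℝ (Fin d) → ℝ}
    {K₀ K : Set (EuclideanSpace ℝ (Fin d))} {ρ L δ α h : ℝ} {N : ℕ}
    (hK : ∀ x ∈ K₀, Metric.closedBall x (3 * ρ) ⊆ K)
    (hfd : ∀ x ∈ K, DifferentiableAt ℝ f x) (hL0 : 0 < L)
    (hL : ∀ x r, Metric.closedBall x r ⊆ K → ∀ y ∈ Metric.closedBall x r,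
      ∀ y' ∈ Metric.closedBall x r, |f y' - f y| ≤ L * ‖y' - y‖)
    (hN : 2 ≤ N) (hh : 0 < h) (hδ : h⁻¹ ≤ δ)
    (hδρ : δ * ∑ y ∈ latticeBox d N, ‖latticePoint y‖ ≤ ρ)
    (hδα : L * (δ * ∑ y ∈ latticeBox d N, ‖latticePoint y‖) ≤ α / 2)
    (hNρ : h⁻¹ * (N + 1) ≤ ρ) (hNα : L * (h⁻¹ * N) ≤ α / 2)
    (hsup : ∀ x ∈ K, 0 ≤ f x → ∑ i, (f (x + h⁻¹ • EuclideanSpace.single i (1 : ℝ)) +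
        f (x - h⁻¹ • EuclideanSpace.single i (1 : ℝ)) - 2 * f x) ≤ 0)
    (htaylor : ∀ e v, Metric.closedBall e (h⁻¹ * (N + 1)) ⊆ K → ‖v‖ ≤ h⁻¹ * (N + 1) →
      f (e + v) ≤ f e + fderiv ℝ f e v + h⁻¹) :
    ∃ u : (Fin d → ℤ) → ℝ, (∀ z, 0 ≤ u z) ∧ ∀ z, h⁻¹ • latticePoint z ∈ K₀ →
      h⁻¹ * u z ≤ max (f (h⁻¹ • latticePoint z) + h⁻¹ * L) 0 ∧
      f (h⁻¹ • latticePoint z) - α ≤ h⁻¹ * u z ∧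
      (discreteLaplacian u z ≤ 0 ∨ u z = 0 ∧ ∃ e ∈ K, -(L * h⁻¹) ≤ f e ∧ f e < 0 ∧
        discreteLaplacian u z ≤
          hamiltonian (gradient f e) + 2 * d * ((L + 1) * (4 * d + 5)) / N) := by
  classical
  set Y := latticeBox d N with hY
  set σ := ∑ y ∈ Y, ‖latticePoint y‖ with hσ
  have hhi : 0 < h⁻¹ := inv_pos.2 hh
  have hδ0 : 0 < δ := hhi.trans_le hδ
  have hσ0 : 0 ≤ σ := Finset.sum_nonneg fun y _ => norm_nonneg _
  have hhρ : h⁻¹ ≤ ρ := by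
    have : h⁻¹ * 1 ≤ h⁻¹ * (N + 1) := by gcongr; linarith [(Nat.cast_nonneg N : (0 : ℝ) ≤ N)]
    linarith
  have hρ0 : 0 < ρ := hhi.trans_le hhρ
  have hα0 : 0 ≤ α := by
    have := mul_nonneg hL0.le (mul_nonneg hδ0.le hσ0)
    linarith
  set X : (Fin d → ℤ) → EuclideanSpace ℝ (Fin d) := fun z => h⁻¹ • latticePoint z with hX
  have hXadd : ∀ z y, X (z + y) = X z + h⁻¹ • latticePoint y := fun z y => by
    simp only [hX, latticePoint_add, smul_add]
  have hXsub : ∀ z y, X (z - y) = X z - h⁻¹ • latticePoint y := fun z y => by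
    simp only [hX, latticePoint_sub, smul_sub]
  set w := latticeComb Y with hw
  have hwn : ∀ t : Y → ℝ, (∀ y, |t y| ≤ δ) → ‖w t‖ ≤ δ * σ := fun t ht => norm_latticeComb_le ht
  -- Near K₀, the complement of D is the Minkowski sum of {f < 0} and the zonotope.
  set D : Set (Fin d → ℤ) := {z | (∃ x ∈ K₀, dist (X z) x ≤ ρ) ∧
    ∀ t : Y → ℝ, (∀ y, |t y| ≤ δ) → 0 ≤ f (X z - w t)} with hD
  -- Lowering by α makes the obstacle vanish near the free boundary while still forcing u/h ≥ f − α
  -- in D.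
  set g : (Fin d → ℤ) → ℝ := fun z => if z ∈ D then max (h * (f (X z) - α)) 0 else 0 with hg
  set v : (Y → ℝ) → (Fin d → ℤ) → ℝ := fun t z => if z ∈ D then h * f (X z - w t) + L else 0 with hv
  have hg0 : ∀ z, 0 ≤ g z := by
    intro z
    simp only [hg]
    split_ifs
    exacts [le_max_right _ _, le_rfl]
  have hgv : ∀ t : Y → ℝ, (∀ y, |t y| ≤ δ) → ∀ z, g z ≤ v t z := by
    intro t ht z
    by_cases hz : z ∈ D
    · simp only [hg, hv, if_pos hz]
      obtain ⟨⟨x, hx, hzx⟩, hzt⟩ := hz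
      have hw1 := (hwn t ht).trans hδρ
      have h1 := hL x _ (hK x hx) (X z - w t)
        (by rw [Metric.mem_closedBall, dist_eq_norm, sub_right_comm]
            refine (norm_sub_le _ _).trans ?_
            rw [← dist_eq_norm]; linarith) (X z)
        (by rw [Metric.mem_closedBall]; linarith)
      rw [sub_sub_cancel] at h1
      have h2 := (abs_le.1 h1).2
      have h3 := mul_le_mul_of_nonneg_left (hwn t ht) hL0.le
      have h4 : h * (f (X z) - α) ≤ h * f (X z - w t) := by gcongr; linarith
      have h5 := mul_nonneg hh.le (hzt t ht)
      exact max_le (by linarith) (by linarith)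
    · simp only [hg, hv, if_neg hz, le_refl]
  have hvD : ∀ t : Y → ℝ, (∀ y, |t y| ≤ δ) → ∀ z ∈ D, discreteLaplacian (v t) z ≤ 0 := by
    intro t ht z hz
    obtain ⟨⟨x, hx, hzx⟩, hzt⟩ := id hz
    have hw1 := (hwn t ht).trans hδρ
    have he : dist (X z - w t) x ≤ 2 * ρ := by
      rw [dist_eq_norm, sub_right_comm]
      refine (norm_sub_le _ _).trans ?_
      rw [← dist_eq_norm]; linarith
    -- The constant L pays for cutting to 0 off D: one step from D the translate of f is at least
    -- −L/h.
    have hnb : ∀ z', ‖X z' - X z‖ ≤ h⁻¹ → v t z' ≤ h * f (X z' - w t) + L := by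
      intro z' hz'
      simp only [hv]
      split_ifs with hzD
      · exact le_rfl
      have h1 := hL x _ (hK x hx) (X z - w t) (by rw [Metric.mem_closedBall]; linarith)
        (X z' - w t) (by
          have h2 := dist_triangle (X z' - w t) (X z - w t) x
          rw [dist_sub_right, dist_eq_norm (X z')] at h2
          rw [Metric.mem_closedBall]; linarith)
      rw [sub_sub_sub_cancel_right] at h1
      have h2 := (abs_le.1 h1).1
      have h3 := hzt t ht
      have h4 : -(L * h⁻¹) ≤ f (X z' - w t) := by
        have := mul_le_mul_of_nonneg_left hz' hL0.le
        linarith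
      have h5 := mul_le_mul_of_nonneg_left h4 hh.le
      have h6 : h * -(L * h⁻¹) = -L := by field_simp
      linarith
    have hsingle : ∀ i : Fin d, ‖h⁻¹ • EuclideanSpace.single i (1 : ℝ)‖ = h⁻¹ := fun i => by
      rw [norm_smul, Real.norm_of_nonneg hhi.le]; simp
    refine (discreteLaplacian_mono (v := fun z => h * f (X z - w t) + L) (if_pos hz)
      (fun i => hnb _ ?_) (fun i => hnb _ ?_)).trans ?_
    · rw [hXadd, latticePoint_single, add_sub_cancel_left, hsingle]
    · rw [hXsub, latticePoint_single, sub_sub_cancel_left, norm_neg, hsingle]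
    · have h1 := hsup (X z - w t) (hK x hx (by rw [Metric.mem_closedBall]; linarith)) (hzt t ht)
      have h2 := mul_nonpos_of_nonneg_of_nonpos hh.le h1
      refine le_trans (le_of_eq ?_) h2
      rw [discreteLaplacian, Finset.mul_sum]
      refine Finset.sum_congr rfl fun i _ => ?_
      rw [hXadd, hXsub, latticePoint_single, add_sub_right_comm (X z) _ (w t),
        sub_right_comm (X z) _ (w t)]
      ring
  have hzero : ∀ y : Y, |(0 : Y → ℝ) y| ≤ δ := fun y => by simpa using hδ0.le
  obtain ⟨u, hgu, huD, hmin, huoff, husub⟩ :=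
    exists_obstacle_solution D g (v 0) (hgv 0 hzero) (hvD 0 hzero)
  have hoff : ∀ z ∉ D, u z = 0 := fun z hz => by rw [huoff z hz]; exact if_neg hz
  refine ⟨u, fun z => (hg0 z).trans (hgu z), fun z hzK => ?_⟩
  by_cases hz : z ∈ D
  · refine ⟨?_, ?_, Or.inl (huD z hz)⟩
    · have h1 := hmin (v 0) (hgv 0 hzero) (hvD 0 hzero) z
      simp only [hv, if_pos hz, map_zero, sub_zero] at h1
      refine le_trans ?_ (le_max_left _ _)
      calc h⁻¹ * u z ≤ h⁻¹ * (h * f (X z) + L) := by gcongr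
        _ = _ := by rw [mul_add, inv_mul_cancel_left₀ hh.ne']
    · have h1 := hgu z
      simp only [hg, if_pos hz] at h1
      have h2 := (le_max_left _ _).trans h1
      calc f (X z) - α = h⁻¹ * (h * (f (X z) - α)) := by rw [inv_mul_cancel_left₀ hh.ne']
        _ ≤ _ := by gcongr
  have huz := hoff z hz
  have hball := hK _ hzK
  obtain ⟨t₀, ht₀, hft₀⟩ : ∃ t₀ : Y → ℝ, (∀ y, |t₀ y| ≤ δ) ∧ f (X z - w t₀) < 0 := by
    by_contra! hcon
    exact hz ⟨⟨X z, hzK, by simpa using hρ0.le⟩, hcon⟩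
  have hmemb : ∀ t : Y → ℝ, (∀ y, |t y| ≤ δ) → dist (X z - w t) (X z) ≤ ρ := by
    intro t ht
    rw [dist_eq_norm, sub_sub_cancel_left, norm_neg]
    exact (hwn t ht).trans hδρ
  have hfar : ∀ t : Y → ℝ, (∀ y, |t y| ≤ δ) → f (X z - w t) < 0 → ∀ x, dist x (X z) ≤ ρ →
      f x ≤ α / 2 + L * ‖x - X z‖ := by
    intro t ht hft x hx
    have h1 := hL _ _ hball (X z - w t) (by have := hmemb t ht; rw [Metric.mem_closedBall]; linarith)
      x (by rw [Metric.mem_closedBall]; linarith)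
    have h2 := (abs_le.1 h1).2
    have h3 : ‖x - (X z - w t)‖ ≤ ‖x - X z‖ + δ * σ := by
      rw [← sub_add]
      exact (norm_add_le _ _).trans (by gcongr; exact hwn t ht)
    have h4 := mul_le_mul_of_nonneg_left h3 hL0.le
    linarith
  refine ⟨?_, ?_, ?_⟩
  · rw [huz, mul_zero]; exact le_max_right _ _
  · have h1 := hfar t₀ ht₀ hft₀ (X z) (by simpa using hρ0.le)
    rw [sub_self, norm_zero, mul_zero] at h1
    rw [huz, mul_zero]
    linarith
  obtain ⟨t, ht, hft, htneg⟩ := exists_latticeComb_nonpos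
    (fun t ht => hfd _ (hball (by have := hmemb t ht; rw [Metric.mem_closedBall]; linarith)))
    ht₀ hft₀
  set e := X z - w t with he
  set p := gradient f e with hp
  have heX := hmemb t ht
  have hpy : ∀ y, inner ℝ p (latticePoint y) = fderiv ℝ f e (latticePoint y) := fun y =>
    inner_gradient f e _
  have hXe : ∀ y, X (z + y) - w t = e + h⁻¹ • latticePoint y := fun y => by
    rw [hXadd, he, add_sub_right_comm]
  -- As t_y ≤ 0 and 1/h ≤ δ, raising t_y by 1/h is admissible and represents z + y over the same e,
  -- where f < 0.
  have hout : ∀ y, ‖latticePoint y‖ ≤ N → inner ℝ p (latticePoint y) ≤ 0 → z + y ∉ D := by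
    intro y hy hpy0 hmem
    have hyY : y ∈ Y := mem_latticeBox_of_norm_le hy
    have hty := htneg ⟨y, hyY⟩ (by rw [← hpy]; exact hpy0)
    have h1 := hmem.2 (t + Pi.single ⟨y, hyY⟩ h⁻¹) (fun j => by
      by_cases hj : j = ⟨y, hyY⟩
      · subst hj
        have := abs_le.1 (ht ⟨y, hyY⟩)
        simp only [Pi.add_apply, Pi.single_eq_same, abs_le]
        exact ⟨by linarith, by linarith⟩
      · simpa [hj] using ht j)
    rw [map_add, latticeComb_single, ← sub_sub, hXe, add_sub_cancel_right] at h1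
    linarith
  by_cases hnear : ∃ y, ‖latticePoint y‖ = 1 ∧ z + y ∈ D
  swap
  · left
    push Not at hnear
    refine Finset.sum_nonpos fun i _ => ?_
    have h1 := hoff _ (hnear (Pi.single i 1) (by rw [latticePoint_single]; simp))
    have h2 := hoff _ (hnear (-Pi.single i 1) (by
      rw [← zero_sub, latticePoint_sub, latticePoint_single]; simp))
    rw [← sub_eq_add_neg] at h2
    rw [huz, h1, h2]; simp
  right
  have hNR : (2 : ℝ) ≤ N := by exact_mod_cast hN
  have hKe : Metric.closedBall e (h⁻¹ * (N + 1)) ⊆ K := by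
    refine (Metric.closedBall_subset_closedBall' ?_).trans hball
    linarith
  obtain ⟨y₀, hy₀, hy₀D⟩ := hnear
  refine ⟨huz, e, hKe (Metric.mem_closedBall_self (by positivity)), ?_, hft, ?_⟩
  · have h1 := hy₀D.2 t ht
    rw [hXe] at h1
    have hn : ‖h⁻¹ • latticePoint y₀‖ = h⁻¹ := by
      rw [norm_smul, Real.norm_of_nonneg hhi.le, hy₀, mul_one]
    have h2 := hL e _ hKe e (Metric.mem_closedBall_self (by positivity))
      (e + h⁻¹ • latticePoint y₀) (by
        rw [Metric.mem_closedBall, dist_eq_norm, add_sub_cancel_left, hn]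
        exact le_mul_of_one_le_right hhi.le (by linarith))
    rw [add_sub_cancel_left, hn] at h2
    have := (abs_le.1 h2).2
    linarith
  -- For p = 0 the half ball would be the whole ball, leaving no neighbour in D.
  have hp0 : p ≠ 0 := by
    intro h0
    exact hout y₀ (by rw [hy₀]; linarith) (by rw [h0]; simp) hy₀D
  -- Here R = N and C = L + 1: L from the competitor `v t`, 1 from the Taylor error h⁻¹ scaled by h.
  refine discreteLaplacian_le_hamiltonian hp0 hNR (by linarith) u z ?_ ?_ ?_
  · intro y hy hpos
    have hyD : z + y ∈ D := by
      by_contra hyD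
      rw [hoff _ hyD] at hpos
      exact lt_irrefl _ hpos
    have hn : ‖h⁻¹ • latticePoint y‖ ≤ h⁻¹ * N := by
      rw [norm_smul, Real.norm_of_nonneg hhi.le]
      gcongr
    have hn' : h⁻¹ * (N : ℝ) ≤ h⁻¹ * (N + 1) := by gcongr; linarith
    have h1 := hfar t ht hft (X (z + y)) (by
      rw [hXadd, dist_eq_norm, add_sub_cancel_left]; linarith)
    rw [hXadd, add_sub_cancel_left, ← hXadd] at h1
    have h2 := mul_le_mul_of_nonneg_left hn hL0.le
    have hgz : g (z + y) = 0 := by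
      simp only [hg, if_pos hyD]
      exact max_eq_right (mul_nonpos_of_nonneg_of_nonpos hh.le (by linarith))
    exact husub _ hyD (by rw [hgz]; exact hpos)
  · intro y hy
    by_cases hyD : z + y ∈ D
    · refine le_trans ?_ (le_max_left _ _)
      have h1 := hmin (v t) (hgv t ht) (hvD t ht) (z + y)
      simp only [hv, if_pos hyD] at h1
      rw [hXe] at h1
      have h2 := htaylor e (h⁻¹ • latticePoint y) hKe (by
        rw [norm_smul, Real.norm_of_nonneg hhi.le]
        gcongr)
      rw [map_smul, ← hpy, smul_eq_mul] at h2
      have h3 := mul_le_mul_of_nonneg_left h2 hh.le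
      have h4 : h * (f e + h⁻¹ * inner ℝ p (latticePoint y) + h⁻¹) =
          h * f e + inner ℝ p (latticePoint y) + 1 := by field_simp
      have h5 := mul_neg_of_pos_of_neg hh hft
      linarith
    · rw [hoff _ hyD]; exact le_max_right _ _
  · intro y hy hpy0
    exact hoff _ (hout y hy.le hpy0)

end Construction

/-! ### Perturbing φ and choosing the parameters. -/

section Perturbation

variable {d : ℕ}

theorem norm_sq_starProjection_secondDifference (S : Submodule ℝ (EuclideanSpace ℝ (Fin d)))
    (x v : EuclideanSpace ℝ (Fin d)) :
    ‖S.starProjection (x + v)‖ ^ 2 + ‖S.starProjection (x - v)‖ ^ 2 -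
      2 * ‖S.starProjection x‖ ^ 2 = 2 * ‖S.starProjection v‖ ^ 2 := by
  rw [map_add, map_sub, norm_add_sq_real, norm_sub_sq_real]
  ring

/-- Projecting onto S before squaring keeps the perturbed gradient in S, the only slopes that the
limsup controls. -/
theorem hasGradientAt_sub_const_mul_norm_sq_starProjection
    (S : Submodule ℝ (EuclideanSpace ℝ (Fin d))) {φ : EuclideanSpace ℝ (Fin d) → ℝ} (κ : ℝ)
    {x : EuclideanSpace ℝ (Fin d)} (hφ : DifferentiableAt ℝ φ x) :
    HasGradientAt (fun x => φ x - κ * (1 + ‖S.starProjection x‖ ^ 2))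
      (gradient φ x - (2 * κ) • S.starProjection x) x := by
  have h1 : HasFDerivAt (fun x => ‖S.starProjection x‖ ^ 2) _ x :=
    S.starProjection.hasFDerivAt.norm_sq
  rw [hasGradientAt_iff_hasFDerivAt]
  refine (hφ.hasFDerivAt.sub ((h1.const_add 1).const_mul κ)).congr_fderiv ?_
  ext v
  have h2 : inner ℝ (S.starProjection x) (S.starProjection v) =
      inner ℝ (S.starProjection x) v := by
    rw [← Submodule.inner_starProjection_left_eq_right,
      Submodule.starProjection_eq_self_iff.2 (Submodule.starProjection_apply_mem S x)]
  simp [h2]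
  ring

/-- Subtracting a small multiple of `1 + ‖P_S x‖²` makes `φ` discretely superharmonic where it is
nonnegative. -/
theorem exists_secondDifference_nonpos {U K : Set (EuclideanSpace ℝ (Fin d))}
    (hU : IsOpen U) (hK : IsCompact K) (hKU : K ⊆ U) {φ : EuclideanSpace ℝ (Fin d) → ℝ}
    (hφ : ContDiffOn ℝ 2 φ U) (hL : ∀ x ∈ U, 0 < φ x → Laplacian.laplacian φ x ≤ 0)
    (S : Submodule ℝ (EuclideanSpace ℝ (Fin d))) (hgrad : ∀ x ∈ U, gradient φ x ∈ S)
    {κ : ℝ} (hκ : 0 < κ) {f : EuclideanSpace ℝ (Fin d) → ℝ}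
    (hf : f = fun x => φ x - κ * (1 + ‖S.starProjection x‖ ^ 2)) :
    ∃ s₀ > (0 : ℝ), ∀ x ∈ K, ∀ s : ℝ, 0 < s → s < s₀ → 0 ≤ f x →
      ∑ i, (f (x + s • EuclideanSpace.single i (1 : ℝ)) +
        f (x - s • EuclideanSpace.single i (1 : ℝ)) - 2 * f x) ≤ 0 := by
  set c := ∑ i, ‖S.starProjection (EuclideanSpace.single i (1 : ℝ))‖ ^ 2 with hc
  have hc0 : 0 ≤ c := Finset.sum_nonneg fun i _ => sq_nonneg _
  have hsum : ∀ (x : EuclideanSpace ℝ (Fin d)) (s : ℝ), ∑ i, (f (x + s • EuclideanSpace.single i (1 : ℝ)) +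
      f (x - s • EuclideanSpace.single i (1 : ℝ)) - 2 * f x) =
      ∑ i, (φ (x + s • EuclideanSpace.single i (1 : ℝ)) +
        φ (x - s • EuclideanSpace.single i (1 : ℝ)) - 2 * φ x) - s ^ 2 * (2 * κ * c) := by
    intro x s
    rw [hc, Finset.mul_sum, Finset.mul_sum, ← Finset.sum_sub_distrib]
    refine Finset.sum_congr rfl fun i _ => ?_
    have h1 := norm_sq_starProjection_secondDifference S x (s • EuclideanSpace.single i (1 : ℝ))
    rw [map_smul, norm_smul, mul_pow, Real.norm_eq_abs, sq_abs] at h1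
    simp only [hf]
    linear_combination (-κ) * h1
  -- If c = 0 then P_S = 0 and the perturbation gains nothing, but ∇φ = 0 and φ is constant on balls
  -- in U. Otherwise the gain 2κc absorbs the second-difference error.
  rcases hc0.eq_or_lt' with hc1 | hc1
  · have hP : ∀ v, S.starProjection v = 0 := by
      intro v
      have h1 : ∀ i, S.starProjection (EuclideanSpace.single i (1 : ℝ)) = 0 := fun i => by
        have := (Finset.sum_eq_zero_iff_of_nonneg fun i _ => sq_nonneg _).1 hc1 i
          (Finset.mem_univ i)
        simpa using this
      have h2 := (EuclideanSpace.basisFun (Fin d) ℝ).sum_repr v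
      rw [← h2, map_sum]
      refine Finset.sum_eq_zero fun i _ => ?_
      rw [map_smul, EuclideanSpace.basisFun_apply, h1, smul_zero]
    have hfd : ∀ x ∈ U, fderiv ℝ φ x = 0 := by
      intro x hx
      have h1 := Submodule.starProjection_eq_self_iff.2 (hgrad x hx)
      rw [hP] at h1
      ext v
      rw [← inner_gradient, ← h1]; simp
    obtain ⟨r, hr, hrU⟩ := hK.exists_cthickening_subset_open hU hKU
    refine ⟨r, hr, fun x hx s hs hsr hfx => ?_⟩
    have hball : Metric.closedBall x r ⊆ U := (Metric.closedBall_subset_cthickening hx r).trans hrU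
    have hconst : ∀ v, ‖v‖ ≤ r → φ (x + v) = φ x := by
      intro v hv
      have h1 := (convex_closedBall x r).norm_image_sub_le_of_norm_fderiv_le (f := φ) (C := 0)
        (x := x) (y := x + v)
        (fun z hz => (hφ.differentiableOn two_ne_zero).differentiableAt (hU.mem_nhds (hball hz)))
        (fun z hz => by rw [hfd z (hball hz), norm_zero])
        (Metric.mem_closedBall_self hr.le)
        (by simpa [Metric.mem_closedBall, dist_eq_norm] using hv)
      rw [zero_mul, norm_le_zero_iff, sub_eq_zero] at h1
      exact h1
    have hsingle : ∀ i : Fin d, ‖s • EuclideanSpace.single i (1 : ℝ)‖ ≤ r := fun i => by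
      rw [norm_smul, Real.norm_of_nonneg hs.le]; simpa using hsr.le
    rw [hsum, hc1, mul_zero, mul_zero, sub_zero]
    refine Finset.sum_nonpos fun i _ => ?_
    rw [hconst _ (hsingle i), sub_eq_add_neg x, hconst _ (by rw [norm_neg]; exact hsingle i)]
    linarith
  · obtain ⟨s₀, hs₀, h⟩ := exists_secondDifference_le hU hK hKU hφ
      (show 0 < 2 * κ * c by positivity)
    refine ⟨s₀, hs₀, fun x hx s hs hss hfx => ?_⟩
    have h1 := h x hx s hs hss
    have h2 : 0 < φ x := by
      have : 0 < κ * (1 + ‖S.starProjection x‖ ^ 2) := by positivity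
      simp only [hf] at hfx
      linarith
    have h3 := mul_nonpos_of_nonneg_of_nonpos (sq_nonneg s) (hL x (hKU hx) h2)
    rw [hsum]
    linarith

theorem eventually_exists_supersolution {U K₀ : Set (EuclideanSpace ℝ (Fin d))} (hU : IsOpen U)
    (hK₀ : IsCompact K₀) (hKU : K₀ ⊆ U) {φ : EuclideanSpace ℝ (Fin d) → ℝ}
    (hφ : ContDiffOn ℝ 2 φ U) (hL : ∀ x ∈ U, 0 < φ x → Laplacian.laplacian φ x ≤ 0)
    (S : Submodule ℝ (EuclideanSpace ℝ (Fin d))) (hgrad : ∀ x ∈ U, gradient φ x ∈ S)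
    (hH : ∀ x ∈ U, φ x = 0 →
      limsup (fun p => (hamiltonian p : EReal))
        (𝓝[(S : Set (EuclideanSpace ℝ (Fin d)))] (gradient φ x)) ≤ 1)
    {ε : ℝ} (hε : 0 < ε) :
    ∀ᶠ h : ℝ in atTop, ∃ u : (Fin d → ℤ) → ℝ, (∀ z, 0 ≤ u z) ∧
      ∀ x ∈ K₀, ∀ z : Fin d → ℤ, latticePoint z = h • x →
        discreteLaplacian u z ≤ (1 + ε) * Set.indicator {w | u w = 0} 1 z ∧
        |h⁻¹ * u z - max (φ x) 0| ≤ ε := by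
  have hφ1 : ContDiffOn ℝ 1 φ U := hφ.of_le one_le_two
  obtain ⟨r, hr, hrU⟩ := hK₀.exists_cthickening_subset_open hU hKU
  set K := Metric.cthickening r K₀ with hKdef
  have hK : IsCompact K := hK₀.cthickening
  obtain ⟨η, hη, hHη⟩ := exists_hamiltonian_le hU hK hrU hφ1 S hH (half_pos hε)
  obtain ⟨B, hB⟩ := hK.exists_bound_of_continuousOn
    (f := fun x => 1 + ‖S.starProjection x‖ ^ 2) (by fun_prop)
  -- One bound on κ(1 + ‖P_S x‖²) controls both the change in value and, as 2a ≤ 1 + a², the change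
  -- in gradient.
  set κ := min (ε / 4) η / max B 1 with hκ
  have hκ0 : 0 < κ := by positivity
  have hκQ : ∀ x ∈ K, κ * (1 + ‖S.starProjection x‖ ^ 2) ≤ min (ε / 4) η := by
    intro x hx
    have h1 := (Real.le_norm_self _).trans ((hB x hx).trans (le_max_left B 1))
    calc κ * (1 + ‖S.starProjection x‖ ^ 2) ≤ κ * max B 1 := by gcongr
      _ = _ := by rw [hκ]; field_simp
  set f : EuclideanSpace ℝ (Fin d) → ℝ := fun x => φ x - κ * (1 + ‖S.starProjection x‖ ^ 2) with hf
  have hfφ : ∀ x, f x ≤ φ x := fun x => by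
    have : 0 < κ * (1 + ‖S.starProjection x‖ ^ 2) := by positivity
    simp only [hf]; linarith
  have hφf : ∀ x ∈ K, φ x ≤ f x + min (ε / 4) η := fun x hx => by
    have := hκQ x hx
    simp only [hf]; linarith
  have hf1 : ContDiffOn ℝ 1 f U := by
    refine hφ1.sub (ContDiff.contDiffOn ?_)
    exact contDiff_const.mul (contDiff_const.add (S.starProjection.contDiff.norm_sq ℝ))
  obtain ⟨L, hL0, hLip⟩ := exists_lipschitz_bound hU hK hrU hf1
  obtain ⟨N₀, hN₀⟩ := exists_nat_ge (2 * d * ((L + 1) * (4 * d + 5)) / (ε / 2))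
  set N := max N₀ 2 with hN
  have hN2 : 2 ≤ N := le_max_right _ _
  have hNpos : (0 : ℝ) < N := by exact_mod_cast (by lia : 0 < N)
  have hNε : 2 * d * ((L + 1) * (4 * d + 5)) / N ≤ ε / 2 := by
    rw [div_le_iff₀ hNpos, ← div_le_iff₀' (half_pos hε)]
    exact hN₀.trans (by exact_mod_cast le_max_left _ _)
  set σ := ∑ y ∈ latticeBox d N, ‖latticePoint y‖ with hσ
  have hσ0 : 0 ≤ σ := Finset.sum_nonneg fun y _ => norm_nonneg _
  -- N and δ are fixed before h, so 1/h ≤ δ and N/h is negligible for large h.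
  set δ := min (r / 3) (ε / 4 / 2 / L) / (σ + 1) with hδ
  have hδ0 : 0 < δ := by positivity
  have hδσ : δ * σ ≤ min (r / 3) (ε / 4 / 2 / L) := by
    calc δ * σ ≤ δ * (σ + 1) := by gcongr; linarith
      _ = _ := by rw [hδ]; field_simp
  obtain ⟨s₀, hs₀, hsup⟩ := exists_secondDifference_nonpos hU hK hrU hφ hL S hgrad hκ0 hf
  obtain ⟨s₁, hs₁, htay⟩ := exists_taylor_bound hU hK hrU hf1
    (show (0 : ℝ) < 1 / (N + 1) by positivity)
  have hsmall : ∀ c b : ℝ, 0 < b → ∀ᶠ h : ℝ in atTop, h⁻¹ * c < b := fun c b hb => by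
    have h1 := (tendsto_inv_atTop_zero (𝕜 := ℝ)).mul_const c
    rw [zero_mul] at h1
    exact h1.eventually (gt_mem_nhds hb)
  filter_upwards [eventually_gt_atTop 0, hsmall 1 δ hδ0, hsmall (N + 1) (r / 3) (by positivity),
    hsmall (L * N) (ε / 4 / 2) (by positivity), hsmall 1 s₀ hs₀, hsmall (N + 1) s₁ hs₁,
    hsmall L η hη, hsmall L ε hε] with h hh h1 h2 h3 h4 h5 h6 h7
  have hhi : 0 < h⁻¹ := inv_pos.2 hh
  rw [mul_one] at h1 h4
  obtain ⟨u, hu0, hu⟩ := exists_discrete_supersolution (f := f) (K₀ := K₀) (K := K) (ρ := r / 3)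
    (L := L) (δ := δ) (α := ε / 4) (h := h) (N := N)
    (fun x hx => by
      rw [mul_div_cancel₀ r (three_ne_zero)]
      exact Metric.closedBall_subset_cthickening hx r)
    (fun x hx => (hf1.differentiableOn one_ne_zero).differentiableAt (hU.mem_nhds (hrU hx)))
    hL0 hLip hN2 hh h1.le (hδσ.trans (min_le_left _ _))
    (by
      rw [← le_div_iff₀' hL0]
      exact hδσ.trans (min_le_right _ _))
    h2.le (by linarith) (fun x hx hfx => hsup x hx h⁻¹ hhi h4 hfx)
    (fun e v hball hv => by
      refine (htay e _ h5 hball v hv).trans ?_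
      have : 1 / (N + 1 : ℝ) * ‖v‖ ≤ h⁻¹ := by
        rw [one_div, inv_mul_le_iff₀ (by positivity)]
        linarith
      linarith)
  refine ⟨u, hu0, fun x hx z hz => ?_⟩
  have hzx : h⁻¹ • latticePoint z = x := by rw [hz, inv_smul_smul₀ hh.ne']
  have hxK : x ∈ K := Metric.self_subset_cthickening K₀ hx
  obtain ⟨hup, hlow, hlap⟩ := hu z (by rwa [hzx])
  rw [hzx] at hup hlow
  constructor
  · rcases hlap with hlap | ⟨huz, e, heK, hfe1, hfe2, hlap⟩
    · refine hlap.trans (mul_nonneg (by linarith) (Set.indicator_nonneg (fun _ _ => ?_) _))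
      exact zero_le_one
    · rw [Set.indicator_of_mem (show z ∈ {w | u w = 0} from huz), Pi.one_apply, mul_one]
      have heU := hrU heK
      have hg := (hasGradientAt_sub_const_mul_norm_sq_starProjection S κ
        ((hφ1.differentiableOn one_ne_zero).differentiableAt (hU.mem_nhds heU))).gradient
      have hpS : gradient f e ∈ S := by
        rw [hg]
        exact S.sub_mem (hgrad e heU) (S.smul_mem _ (Submodule.starProjection_apply_mem S e))
      have hφe : |φ e| ≤ η := by
        rw [abs_le]
        have h8 := hfφ e
        have h9 := hφf e heK
        have h10 := min_le_right (ε / 4) η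
        exact ⟨by linarith, by linarith⟩
      have hpn : ‖gradient f e - gradient φ e‖ ≤ η := by
        rw [hg, sub_sub_cancel_left, norm_neg, norm_smul, Real.norm_of_nonneg (by positivity)]
        refine le_trans ?_ ((hκQ e heK).trans (min_le_right _ _))
        nlinarith [sq_nonneg (‖S.starProjection e‖ - 1)]
      have := hHη e heK hφe _ hpS hpn
      linarith
  · have h8 := hfφ x
    have h9 := hφf x hxK
    have h10 := min_le_left (ε / 4) η
    have h11 : 0 ≤ h⁻¹ * u z := mul_nonneg hhi.le (hu0 z)
    have h12 : h⁻¹ * u z ≤ max (φ x) 0 + ε := hup.trans (max_le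
      (by linarith [le_max_left (φ x) 0]) (by linarith [le_max_right (φ x) 0]))
    have h13 : max (φ x) 0 ≤ h⁻¹ * u z + ε := max_le (by linarith) (by linarith)
    rw [abs_le]
    exact ⟨by linarith, by linarith⟩

end Perturbation

/-! ### Errors tending to zero along the sequence. -/

/-- Take the infimum of the nonnegative admissible errors; it may not be attained, so 1/(n + 1) is
added. -/
theorem exists_tendsto_zero_forall {P : ℕ → ℝ → Prop} (hmono : ∀ n a b, a ≤ b → P n a → P n b)
    (hne : ∀ n, ∃ a, P n a) (hev : ∀ ε > 0, ∀ᶠ n in atTop, P n ε) :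
    ∃ ε : ℕ → ℝ, Tendsto ε atTop (𝓝 0) ∧ ∀ n, P n (ε n) := by
  set A : ℕ → Set ℝ := fun n => {a | 0 ≤ a ∧ P n a} with hA
  have hAne : ∀ n, (A n).Nonempty := fun n => by
    obtain ⟨a, ha⟩ := hne n
    exact ⟨max a 0, le_max_right _ _, hmono n _ _ (le_max_left _ _) ha⟩
  have hAb : ∀ n, BddBelow (A n) := fun n => ⟨0, fun a ha => ha.1⟩
  have hA0 : ∀ n, 0 ≤ sInf (A n) := fun n => le_csInf (hAne n) fun a ha => ha.1
  refine ⟨fun n => sInf (A n) + 1 / ((n : ℝ) + 1), ?_, fun n => ?_⟩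
  · have h1 : Tendsto (fun n => sInf (A n)) atTop (𝓝 0) := by
      refine tendsto_order.2 ⟨fun a ha => Eventually.of_forall fun n => ha.trans_le (hA0 n),
        fun a ha => ?_⟩
      filter_upwards [hev (a / 2) (half_pos ha)] with n hn
      exact (csInf_le (hAb n) ⟨(half_pos ha).le, hn⟩).trans_lt (half_lt_self ha)
    simpa using h1.add tendsto_one_div_add_atTop_nhds_zero_nat
  · obtain ⟨a, ha, hlt⟩ := exists_lt_of_csInf_lt (hAne n)
      (lt_add_of_pos_right (sInf (A n)) (Nat.one_div_pos_of_nat (α := ℝ) (n := n)))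
    exact hmono n a _ hlt.le ha.2

theorem theoremt {d : ℕ} (U : Set (EuclideanSpace ℝ (Fin d))) (hUopen : IsOpen U)
    (hUbdd : Bornology.IsBounded U)
    (φ : EuclideanSpace ℝ (Fin d) → ℝ) (hφ : ContDiffOn ℝ ∞ φ U)
    (hL : ∀ x ∈ U, 0 < φ x → Laplacian.laplacian φ x ≤ 0)
    (S : Submodule ℝ (EuclideanSpace ℝ (Fin d)))
    (hgrad : ∀ x ∈ U, gradient φ x ∈ S)
    (hH : ∀ x ∈ U, φ x = 0 →
      limsup (fun p => (hamiltonian p : EReal))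
        (𝓝[(S : Set (EuclideanSpace ℝ (Fin d)))] (gradient φ x)) ≤ 1)
    (V : Set (EuclideanSpace ℝ (Fin d))) (hVopen : IsOpen V) (hVU : closure V ⊆ U)
    (h : ℕ → ℝ) (hh : Tendsto h atTop atTop) :
    ∃ (u : ℕ → (Fin d → ℤ) → ℝ) (ε : ℕ → ℝ),
      Tendsto ε atTop (𝓝 0) ∧
      (∀ n z, 0 ≤ u n z) ∧
      ∀ n, ∀ x ∈ V, ∀ z : Fin d → ℤ, latticePoint z = h n • x →
        discreteLaplacian (u n) z ≤ (1 + ε n) * Set.indicator {w | u n w = 0} 1 z ∧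
        |(h n)⁻¹ * u n z - max (φ x) 0| ≤ ε n := by
  have hK₀ : IsCompact (closure V) :=
    Metric.isCompact_of_isClosed_isBounded isClosed_closure (hUbdd.subset hVU)
  have hφ2 : ContDiffOn ℝ 2 φ U := hφ.of_le (WithTop.coe_le_coe.2 le_top)
  set P : ℕ → ℝ → Prop := fun n ε => ∃ u : (Fin d → ℤ) → ℝ, (∀ z, 0 ≤ u z) ∧
    ∀ x ∈ V, ∀ z : Fin d → ℤ, latticePoint z = h n • x →
      discreteLaplacian u z ≤ (1 + ε) * Set.indicator {w | u w = 0} 1 z ∧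
      |(h n)⁻¹ * u z - max (φ x) 0| ≤ ε with hP
  obtain ⟨ε, hε, hPε⟩ := exists_tendsto_zero_forall (P := P)
    (fun n a b hab => by
      rintro ⟨u, hu0, hu⟩
      refine ⟨u, hu0, fun x hx z hz => ⟨(hu x hx z hz).1.trans ?_, (hu x hx z hz).2.trans hab⟩⟩
      exact mul_le_mul_of_nonneg_right (by linarith)
        (Set.indicator_nonneg (fun _ _ => zero_le_one) _))
    (fun n => by
      obtain ⟨B, hB⟩ := hK₀.exists_bound_of_continuousOn (hφ.continuousOn.mono hVU)
      -- Every n admits some error: u = 0 works, with the bound of φ on the closure of V.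
      refine ⟨max B 0, fun _ => 0, fun _ => le_rfl, fun x hx z _ => ⟨?_, ?_⟩⟩
      · rw [Set.indicator_of_mem (by simp)]
        simp only [discreteLaplacian, add_zero, mul_zero, sub_zero, Finset.sum_const_zero,
          Pi.one_apply, mul_one]
        positivity
      · rw [mul_zero, zero_sub, abs_neg, abs_of_nonneg (le_max_right _ _)]
        exact max_le_max_right 0 ((Real.le_norm_self _).trans (hB x (subset_closure hx))))
    (fun ε hε => by
      filter_upwards [hh.eventually (eventually_exists_supersolution hUopen hK₀ hVU hφ2 hL S hgrad
        hH hε)] with n hn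
      obtain ⟨u, hu0, hu⟩ := hn
      exact ⟨u, hu0, fun x hx => hu x (subset_closure hx)⟩)
  choose u hu0 hu using hPε
  exact ⟨u, ε, hε, hu0, hu⟩
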